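/- Let $\mathfrak{g}$ be a finite-dimensional complex semisimple Lie algebra with universal enveloping algebra $U\mathfrak{g}$, and let $n \geq 1$. Let $R_{\mathfrak{g}} = S_n \wr U\mathfrak{g} := (U\mathfrak{g})^{\otimes n} \rtimes S_n$ be the wreath product algebra: the tensor power is over $\mathbb{C}$, the symmetric group $S_n$ acts on it by permuting the tensor factors, and $\rtimes$ denotes the skew group ring, with multiplication $(a\sigma)(b\tau) = a\,\sigma(b)\,\sigma\tau$ for $a,b \in (U\mathfrak{g})^{\otimes n}$ and $\sigma,\tau \in S_n$. Fix a Cartan subalgebra $\mathfrak{h} \subset \mathfrak{g}$ and a base of the root system of $(\mathfrak{g},\mathfrak{h})$, and let $P^+_{\mathfrak{g}} \subset \mathfrak{h}^*$ be the set of dominant integral weights, i.e. of those $\lambda \in \mathfrak{h}^*$ with $\lambda(h_\alpha) \in \mathbb{Z}_{\geq 0}$ for every simple root $\alpha$, where $h_\alpha \in \mathfrak{h}$ is the coroot of $\alpha$. Then the abelian category of $R_{\mathfrak{g}}$-modules that are finite-dimensional over $\mathbb{C}$ is semisimple, that is, each of its objects is a finite direct sum of simple objects. Moreover, it contains at least $|P^+_{\mathfrak{g}}|$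 simple objects up to isomorphism: there is a family $(V_\lambda)_{\lambda \in P^+_{\mathfrak{g}}}$ of pairwise non-isomorphic simple objects. -/

import Mathlib

open CategoryTheory CategoryTheory.Limits
open scoped TensorProduct

universe u v w

noncomputable section

/-! ### The wreath product algebra -/

section Wreath

variable (k : Type u) [CommRing k] (A : Type v) [Ring A] [Algebra k A] (n : ℕ)

/-- The symmetric group `S_n` acts on `A^{⊗ n}` by ring automorphisms permuting the tensor
factors: `σ • (a_1 ⊗ ⋯ ⊗ a_n)` has `a_{σ⁻¹ j}` in position `j`. -/
instance tensorPowerPermAction :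
    MulSemiringAction (Equiv.Perm (Fin n)) (⨂[k] _ : Fin n, A) where
  smul σ x := PiTensorProduct.reindex k (fun _ : Fin n => A) σ x
  one_smul x := by
    change PiTensorProduct.reindex k (fun _ : Fin n => A) (Equiv.refl (Fin n)) x = x
    rw [PiTensorProduct.reindex_refl]; rfl
  mul_smul σ τ x := by
    exact (PiTensorProduct.reindex_reindex (R := k) (s := fun _ : Fin n => A) τ σ x).symm
  smul_zero σ := map_zero (PiTensorProduct.reindex k (fun _ : Fin n => A) σ)
  smul_add σ x y := map_add (PiTensorProduct.reindex k (fun _ : Fin n => A) σ) x y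
  smul_one σ := by
    change PiTensorProduct.reindex k (fun _ : Fin n => A) σ (PiTensorProduct.tprod k 1) = _
    rw [PiTensorProduct.reindex_tprod]; rfl
  smul_mul σ x y := by
    change PiTensorProduct.reindex k (fun _ : Fin n => A) σ (x * y) =
      PiTensorProduct.reindex k (fun _ : Fin n => A) σ x *
        PiTensorProduct.reindex k (fun _ : Fin n => A) σ y
    induction x using PiTensorProduct.induction_on with
    | add x₁ x₂ h₁ h₂ => simp only [add_mul, map_add, h₁, h₂]
    | smul_tprod r f =>
      induction y using PiTensorProduct.induction_on with
      | add y₁ y₂ h₁ h₂ => simp only [mul_add, map_add, h₁, h₂]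
      | smul_tprod s g =>
        simp only [PiTensorProduct.smul_tprod_mul_smul_tprod, map_smul,
          PiTensorProduct.reindex_tprod]
        rfl

theorem perm_smul_tprod (σ : Equiv.Perm (Fin n)) (a : Fin n → A) :
    σ • (PiTensorProduct.tprod k a : ⨂[k] _ : Fin n, A) =
      PiTensorProduct.tprod k (fun j => a (σ.symm j)) :=
  PiTensorProduct.reindex_tprod (R := k) (s := fun _ : Fin n => A) σ a

instance tensorPowerPermSMulComm :
    SMulCommClass (Equiv.Perm (Fin n)) k (⨂[k] _ : Fin n, A) where
  smul_comm σ r x := map_smul (PiTensorProduct.reindex k (fun _ : Fin n => A) σ) r x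

/-- The wreath product algebra `S_n ≀ A = A^{⊗ n} ⋊ S_n`: the skew group ring of `S_n` over
`A^{⊗ n}`, with multiplication `(a σ) (b τ) = (a * (σ • b)) (σ τ)`. -/
abbrev WreathAlgebra : Type (max u v) :=
  SkewMonoidAlgebra (⨂[k] _ : Fin n, A) (Equiv.Perm (Fin n))

end Wreath

/-! ### The category of finite-dimensional modules -/

section FinDim

variable (k : Type u) [Field k] (R : Type v) [Ring R] [Algebra k R]

/-- Finite-dimensionality over `k` of a module `M` over a `k`-algebra `R`, where `k` acts on `M`
through the structure map `k → R`. -/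
def isFinDim : ObjectProperty (ModuleCat.{w} R) := fun M =>
  letI : Module k M := Module.compHom M (algebraMap k R)
  FiniteDimensional k M

/-- The category of (left) `R`-modules that are finite-dimensional over `k`, as a full
subcategory of the category of all `R`-modules. -/
abbrev FinDimModuleCat : Type (max v (w + 1)) := (isFinDim.{u, v, w} k R).FullSubcategory

section

variable {k R}

/-- Any `R`-linear map is `k`-linear. -/
def restrictLinear {M N : ModuleCat.{w} R} (f : M →ₗ[R] N) :
    letI : Module k M := Module.compHom M (algebraMap k R)
    letI : Module k N := Module.compHom N (algebraMap k R)
    M →ₗ[k] N :=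
  letI : Module k M := Module.compHom M (algebraMap k R)
  letI : Module k N := Module.compHom N (algebraMap k R)
  { toFun := f
    map_add' := f.map_add
    map_smul' := fun r x => f.map_smul (algebraMap k R r) x }

end

instance : (isFinDim.{u, v, w} k R).IsClosedUnderSubobjects where
  prop_of_mono {X Y} f hf hY := by
    let : Module k X := Module.compHom X (algebraMap k R)
    let : Module k Y := Module.compHom Y (algebraMap k R)
    have : FiniteDimensional k Y := hY
    exact Module.Finite.of_injective (restrictLinear (k := k) f.hom)
      ((ModuleCat.mono_iff_injective f).1 hf)

instance : (isFinDim.{u, v, w} k R).IsClosedUnderQuotients where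
  prop_of_epi {X Y} f hf hX := by
    let : Module k X := Module.compHom X (algebraMap k R)
    let : Module k Y := Module.compHom Y (algebraMap k R)
    have : FiniteDimensional k X := hX
    exact Module.Finite.of_surjective (restrictLinear (k := k) f.hom)
      ((ModuleCat.epi_iff_surjective f).1 hf)

instance : (isFinDim.{u, v, w} k R).ContainsZero where
  exists_zero := by
    refine ⟨ModuleCat.of R PUnit, ModuleCat.isZero_of_subsingleton _, ?_⟩
    let : Module k (ModuleCat.of R PUnit.{w + 1}) := Module.compHom _ (algebraMap k R)
    have : Finite (ModuleCat.of R PUnit.{w + 1}) := inferInstanceAs (Finite PUnit)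
    exact Module.Finite.of_finite

instance : (isFinDim.{u, v, w} k R).IsClosedUnderFiniteProducts where
  isClosedUnderLimitsOfShape J _ := by
    refine ⟨?_⟩
    rintro X ⟨p⟩
    let P : ModuleCat.{w} R := ModuleCat.of R (∀ j : J, p.diag.obj ⟨j⟩)
    let φ : X ⟶ P := ModuleCat.ofHom (LinearMap.pi fun j => (p.π.app ⟨j⟩).hom)
    have hφ : ∀ j : J,
        φ ≫ ModuleCat.ofHom (LinearMap.proj j : (∀ j : J, p.diag.obj ⟨j⟩) →ₗ[R] _) =
          p.π.app ⟨j⟩ := fun j => by ext; rfl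
    have : Mono φ := ⟨fun a b h => p.isLimit.hom_ext fun ⟨j⟩ => by
      change a ≫ p.π.app ⟨j⟩ = b ≫ p.π.app ⟨j⟩
      rw [← hφ j, ← Category.assoc, h, Category.assoc]⟩
    refine (isFinDim k R).prop_of_mono φ ?_
    let (j : J) : Module k (p.diag.obj ⟨j⟩) := Module.compHom _ (algebraMap k R)
    have (j : J) : FiniteDimensional k (p.diag.obj ⟨j⟩) := p.prop_diag_obj ⟨j⟩
    exact (inferInstance : FiniteDimensional k (∀ j : J, p.diag.obj ⟨j⟩))

end FinDim

/-! ### Semisimple categories -/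

/-- An abelian category is semisimple if every object is isomorphic to a finite direct sum of
simple objects. The empty direct sum is allowed: it is the zero object. -/
def IsSemisimpleCategory (C : Type v) [Category.{w} C] [Abelian C] : Prop :=
  haveI : HasFiniteBiproducts C := Abelian.hasFiniteBiproducts
  ∀ X : C, ∃ (m : ℕ) (S : Fin m → C), (∀ i, Simple (S i)) ∧ Nonempty (X ≅ ⨁ S)

/-! ### Dominant integral weights -/

/-- The dominant integral weights of a complex semisimple Lie algebra `g`, with respect to a
Cartan subalgebra `H` and a base `b` of the root system of `(g, H)`: the linear forms `μ` on `H`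
which take values in the non-negative integers on all the simple coroots. -/
def dominantIntegralWeights {g : Type u} [LieRing g] [LieAlgebra ℂ g] [FiniteDimensional ℂ g]
    [LieAlgebra.IsSemisimple ℂ g] {H : LieSubalgebra ℂ g} [H.IsCartanSubalgebra]
    (b : (LieAlgebra.IsKilling.rootSystem H).Base) : Set (Module.Dual ℂ H) :=
  {μ | ∀ i ∈ b.support, ∃ m : ℕ, μ ((LieAlgebra.IsKilling.rootSystem H).coroot i) = m}

end

/-!
The proof of semisimplicity has three layers. Weyl's theorem is proved over any field of
characteristic zero in the form `M = g M + M^g` (`LieModule.lie_top_sup_maxTrivSubmodule`). If `g`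
acts non-trivially on `M`, then by Cartan's criterion the trace form of `M` is not zero, and the
Casimir endomorphism of its non-degenerate part has non-zero trace, so it is not nilpotent; the
Fitting decomposition of `M` with respect to it splits off a summand contained in `g M`, and one
concludes by induction on the dimension. Applied to spaces of linear maps this gives equivariant
projections onto submodules (`LieModule.exists_equivariant_projection`). A finite-dimensional module
over `S_n ≀ U(g)` is a module over the Lie algebra `g^n`, which is semisimple too, and averaging an
equivariant projection over `S_n` as in Maschke's theorem makes it linear over `S_n ≀ U(g)`
(`WreathAlgebra.isSemisimpleModule`). Finally, a finite-dimensional semisimple module is a biproduct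
of simple objects in the category of finite-dimensional modules
(`FinDimModuleCat.exists_iso_biproduct`).

The second assertion is a statement about the number of simple objects. A dominant integral weight
is determined by its values on the simple coroots, so there are only countably many of them, and it
is enough to produce infinitely many simple objects if there is a simple root. Let `h` and `e` be
the neutral element and the nilpositive element of an `sl₂`-triple of that root. Then `h` has the
eigenvalue `2 d` on the `d`-th tensor power of the adjoint representation of `g`; on the `n`-th
tensor power of this space, a module over `S_n ≀ U(g)`, the element `h ⊗ 1 ⊗ ⋯ ⊗ 1` has the
eigenvalue `2 d`, and so it has on some simple summand. As `h ⊗ 1 ⊗ ⋯ ⊗ 1` has only finitely many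
eigenvalues on each of these summands, they fall into infinitely many isomorphism classes
(`FinDimModuleCat.exists_pairwise_not_iso`). If there are no simple roots, then there is at most one
dominant integral weight, and a single simple object is enough.
-/

/-! ### Weyl's theorem -/

/-- A Lie algebra with non-degenerate Killing form is perfect: the Killing complement of `⁅L, L⁆` is
an abelian ideal. -/
theorem LieAlgebra.lie_top_top_of_isKilling {K L : Type*} [Field K] [LieRing L]
    [LieAlgebra K L] [FiniteDimensional K L] [LieAlgebra.IsKilling K L] :
    ⁅(⊤ : LieIdeal K L), (⊤ : LieIdeal K L)⁆ = ⊤ := by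
  set D : LieIdeal K L := ⁅(⊤ : LieIdeal K L), (⊤ : LieIdeal K L)⁆ with hD
  have hc := LieIdeal.isCompl_killingCompl (K := K) (L := L) D
  have hab : IsLieAbelian (LieIdeal.killingCompl K L D) := by
    refine ⟨fun x y => Subtype.ext ?_⟩
    have h1 : ⁅(x : L), (y : L)⁆ ∈ D ⊓ LieIdeal.killingCompl K L D :=
      ⟨LieSubmodule.lie_mem_lie (LieSubmodule.mem_top _) (LieSubmodule.mem_top _),
        LieSubmodule.lie_mem _ y.2⟩
    rw [hc.inf_eq_bot] at h1
    exact h1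
  have := LieAlgebra.HasTrivialRadical.eq_bot_of_isSolvable (R := K) (L := L)
    (LieIdeal.killingCompl K L D)
  have h2 := hc.sup_eq_top
  rwa [this, sup_bot_eq] at h2

namespace LieModule

variable {K L M : Type*} [Field K] [CharZero K] [LieRing L] [LieAlgebra K L]
  [FiniteDimensional K L] [LieAlgebra.IsKilling K L]
  [AddCommGroup M] [Module K M] [LieRingModule L M] [LieModule K L M]

/-- By Cartan's criterion a module with zero trace form is nilpotent, and a nilpotent module over a
perfect Lie algebra is trivial. -/
theorem lie_eq_zero_of_traceForm_eq_zero [FiniteDimensional K M]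
    (h : traceForm K L M = 0) (x : L) (m : M) :
    ⁅x, m⁆ = 0 := by
  have hnil := isNilpotent_derivedSeries_of_traceForm_eq_zero h
  have htop : LieAlgebra.derivedSeries K L 1 = ⊤ := by
    simpa [LieAlgebra.derivedSeries_def, LieAlgebra.derivedSeriesOfIdeal_succ] using
      LieAlgebra.lie_top_top_of_isKilling (K := K) (L := L)
  rw [htop] at hnil
  have hnil' : LieModule.IsNilpotent L M := by
    rw [isNilpotent_iff_forall' (R := K)] at hnil ⊢
    exact fun y => hnil ⟨y, LieSubmodule.mem_top y⟩
  obtain ⟨k, hk⟩ := (isNilpotent_iff K L M).1 hnil'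
  -- as `L` is perfect, `⁅x, m⁆` can be rewritten as a sum of arbitrarily long iterated brackets
  have hstep : ∀ j (x : L) (m : M), ⁅x, m⁆ ∈ lowerCentralSeries K L M j := by
    intro j
    induction j with
    | zero => simp
    | succ j ih =>
      intro x m
      have hx : x ∈ ⁅(⊤ : LieIdeal K L), (⊤ : LieIdeal K L)⁆ := by
        rw [LieAlgebra.lie_top_top_of_isKilling]; exact LieSubmodule.mem_top x
      rw [← LieSubmodule.mem_toSubmodule, LieSubmodule.lieIdeal_oper_eq_linear_span'] at hx
      rw [lowerCentralSeries_succ]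
      induction hx using Submodule.span_induction with
      | mem x hx =>
        obtain ⟨y, -, z, -, rfl⟩ := hx
        rw [lie_lie]
        exact sub_mem (LieSubmodule.lie_mem_lie (LieSubmodule.mem_top _) (ih _ _))
          (LieSubmodule.lie_mem_lie (LieSubmodule.mem_top _) (ih _ _))
      | zero => simp
      | add x y _ _ hx hy => rw [add_lie]; exact add_mem hx hy
      | smul a x _ hx => rw [smul_lie]; exact SMulMemClass.smul_mem a hx
  simpa [hk] using hstep k x m

/-- The Casimir endomorphism of a module with non-zero trace form. It is taken with respect to the
restriction of the trace form to the ideal `J` complementary to its radical, where the form is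
non-degenerate; its trace on the module is `dim J ≠ 0`, so it is not nilpotent. -/
theorem exists_commute_not_isNilpotent (h : traceForm K L M ≠ 0) :
    ∃ C : Module.End K M, (∀ x : L, Commute (toEnd K L M x) C) ∧
      (∀ m, C m ∈ ⁅(⊤ : LieIdeal K L), (⊤ : LieSubmodule K L M)⁆) ∧ ¬ _root_.IsNilpotent C := by
  classical
  set T := traceForm K L M with hT
  -- the radical of the trace form
  let I : LieIdeal K L :=
    { LinearMap.ker T with
      lie_mem := by
        intro x m hm
        change T _ = 0
        ext z
        have : T m = 0 := hm
        rw [hT, ← lie_skew, map_neg, LinearMap.neg_apply, traceForm_apply_lie_apply, ← hT, this]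
        simp }
  set J := LieIdeal.killingCompl K L I
  have hc : IsCompl I J := LieIdeal.isCompl_killingCompl I
  have hJ : J ≠ ⊥ := by
    intro hJ
    have hI : I = ⊤ := by simpa [hJ] using hc.sup_eq_top
    exact h (LinearMap.ext fun x => (hI ▸ LieSubmodule.mem_top x : x ∈ I))
  let B : LinearMap.BilinForm K J := T.restrict J.toSubmodule
  have hBsymm : B.IsSymm := ⟨fun x y => traceForm_comm K L M _ _⟩
  have hB : B.Nondegenerate := by
    refine hBsymm.isRefl.nondegenerate_iff_separatingLeft.2 fun x hx => ?_
    have hxI : (x : L) ∈ I := by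
      change T x = 0
      ext z
      have hz : z ∈ I ⊔ J := hc.sup_eq_top ▸ LieSubmodule.mem_top z
      obtain ⟨i, hi, j, hj, rfl⟩ := (LieSubmodule.mem_sup _ _ _).1 hz
      have h1 : T i = 0 := hi
      have h2 : T x j = 0 := hx ⟨j, hj⟩
      rw [map_add, h2, hT, traceForm_comm, ← hT, h1]; simp
    have : (x : L) ∈ I ⊓ J := ⟨hxI, x.2⟩
    rw [hc.inf_eq_bot] at this
    exact Subtype.ext this
  let b := Module.finBasis K J
  let b' := B.dualBasis hB b
  have hb' : ∀ y : J, y = ∑ j, B y (b j) • b' j := fun y => by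
    conv_lhs => rw [← b'.sum_repr y]
    simp only [b', LinearMap.BilinForm.dualBasis_repr_apply]
  have hb : ∀ y : J, y = ∑ j, B (b' j) y • b j := fun y => by
    have : ∀ j, B (b' j) y = b.repr y j := fun j => by
      conv_lhs => rw [← b.sum_repr y, map_sum]
      simp only [b', map_smul, LinearMap.BilinForm.apply_dualBasis_left, smul_eq_mul, mul_ite, mul_one,
        mul_zero, Finset.sum_ite_eq', Finset.mem_univ, if_true]
    simp only [this, b.sum_repr]
  let φ := toEnd K L M
  let C : Module.End K M := ∑ i, φ (b' i) * φ (b i)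
  refine ⟨C, ?_, ?_, ?_⟩
  · intro x
    have hφ' : ∀ y : J, φ y = ∑ j, B y (b j) • φ (b' j) := fun y => by
      conv_lhs => rw [hb' y]
      simp
    have hφ : ∀ y : J, φ y = ∑ j, B (b' j) y • φ (b j) := fun y => by
      conv_lhs => rw [hb y]
      simp
    have hl : ∀ i, φ x * (φ (b' i) * φ (b i)) - φ (b' i) * φ (b i) * φ x =
        φ (⁅x, b' i⁆ : J) * φ (b i) + φ (b' i) * φ (⁅x, b i⁆ : J) := by
      intro i
      simp only [LieSubmodule.coe_bracket, φ, LieHom.map_lie, Ring.lie_def]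
      noncomm_ring
    have hinv : ∀ i j, B ⁅x, b' i⁆ (b j) = - B (b' i) ⁅x, b j⁆ := fun i j =>
      LieModule.traceForm_apply_lie_apply' K L M _ _ _
    -- the coefficient of `φ (b' j) * φ (b i)` in the commutator is zero by invariance of `B`
    have : φ x * C - C * φ x = 0 := by
      rw [Finset.mul_sum, Finset.sum_mul, ← Finset.sum_sub_distrib]
      simp_rw [hl, Finset.sum_add_distrib, hφ' ⁅x, b' _⁆, hφ ⁅x, b _⁆, Finset.sum_mul,
        Finset.mul_sum, hinv]
      rw [Finset.sum_comm, ← Finset.sum_add_distrib]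
      refine Finset.sum_eq_zero fun i _ => ?_
      rw [← Finset.sum_add_distrib]
      exact Finset.sum_eq_zero fun j _ => by simp
    exact sub_eq_zero.1 this
  · intro m
    rw [LinearMap.sum_apply]
    exact sum_mem fun i _ => LieSubmodule.lie_mem_lie (LieSubmodule.mem_top _)
      (LieSubmodule.mem_top _)
  · intro hC
    have h1 : LinearMap.trace K M C = Module.finrank K J := by
      have : ∀ i, LinearMap.trace K M (φ (b' i) * φ (b i)) = 1 := fun i => by
        simpa using! LinearMap.BilinForm.apply_dualBasis_left hB b i i
      simp [C, map_sum, this]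
    have h2 := (LinearMap.isNilpotent_trace_of_isNilpotent hC).eq_zero
    rw [h1, Nat.cast_eq_zero, Module.finrank_eq_zero_iff_of_free] at h2
    exact hJ ((LieSubmodule.eq_bot_iff _).2 fun x hx =>
      congrArg Subtype.val (Subsingleton.elim (⟨x, hx⟩ : J) 0))

/-- **Weyl's theorem**, in the form that the invariants of a finite-dimensional module `M` together
with the brackets `⁅x, m⁆` span `M`. By induction on the dimension: if the trace form of `M` is not
zero, then `M` is the sum of the range of a power of the Casimir endomorphism, which consists of sums
of brackets, and of the kernel of that power, which is a proper submodule. -/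
theorem lie_top_sup_maxTrivSubmodule [FiniteDimensional K M] :
    ⁅(⊤ : LieIdeal K L), (⊤ : LieSubmodule K L M)⁆ ⊔ maxTrivSubmodule K L M = ⊤ := by
  induction hd : Module.finrank K M using Nat.strong_induction_on generalizing M with
  | _ d ih =>
  by_cases hT : traceForm K L M = 0
  · have : maxTrivSubmodule K L M = ⊤ := by
      rw [eq_top_iff]
      exact fun m _ => (mem_maxTrivSubmodule K L M m).2 fun x =>
        lie_eq_zero_of_traceForm_eq_zero hT x m
    rw [this, sup_top_eq]
  obtain ⟨C, hcomm, hCmem, hCnil⟩ := exists_commute_not_isNilpotent hT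
  obtain ⟨k, hk⟩ := Filter.eventually_atTop.1 (LinearMap.eventually_isCompl_ker_pow_range_pow C)
  have hcompl := hk (k + 1) k.le_succ
  let N : LieSubmodule K L M :=
    { LinearMap.ker (C ^ (k + 1)) with
      lie_mem := by
        intro x m hm
        have hm' : (C ^ (k + 1)) m = 0 := hm
        have := LinearMap.congr_fun ((hcomm x).pow_right (k + 1)).eq m
        change (C ^ (k + 1)) ⁅x, m⁆ = 0
        simpa [hm', eq_comm] using this }
  have hN : Module.finrank K N < d := by
    rw [← hd]
    refine Submodule.finrank_lt (s := N.toSubmodule) ?_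
    intro htop
    exact hCnil ⟨k + 1, LinearMap.ker_eq_top.1 htop⟩
  have ihN := ih _ hN (M := N) rfl
  rw [eq_top_iff]
  intro m _
  obtain ⟨m₀, hm₀, m₁, hm₁, rfl⟩ := Submodule.mem_sup.1
    (hcompl.sup_eq_top ▸ Submodule.mem_top (x := m))
  refine add_mem ?_ (SetLike.le_def.1 le_sup_left ?_)
  · have h0 : (⟨m₀, hm₀⟩ : N) ∈ (⊤ : LieSubmodule K L N) := LieSubmodule.mem_top _
    rw [← ihN] at h0
    obtain ⟨p, hp, q, hq, hpq⟩ := (LieSubmodule.mem_sup _ _ _).1 h0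
    have hpq' : m₀ = p + q := congrArg Subtype.val hpq.symm
    rw [hpq']
    refine (LieSubmodule.mem_sup _ _ _).2 ⟨p, ?_, q, ?_, rfl⟩
    · have := LieSubmodule.mem_map_of_mem (f := N.incl) hp
      rw [LieSubmodule.map_bracket_eq] at this
      exact LieSubmodule.mono_lie_right _ le_top this
    · rw [mem_maxTrivSubmodule] at hq ⊢
      exact fun x => congrArg Subtype.val (hq x)
  · obtain ⟨n, rfl⟩ := hm₁
    rw [pow_succ']
    exact hCmem _

end LieModule

/-! ### Complete reducibility over direct sums -/

namespace LieAlgebra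

open DirectSum in
/-- A direct sum of Lie algebras with trivial radical has trivial radical. -/
instance hasTrivialRadical_directSum {K ι : Type*} {L : ι → Type*} [CommRing K]
    [∀ i, LieRing (L i)] [∀ i, LieAlgebra K (L i)] [∀ i, HasTrivialRadical K (L i)] :
    HasTrivialRadical K (⨁ i, L i) := by
  classical
  rw [hasTrivialRadical_iff_no_abelian_ideals]
  intro I hI
  have hIab : ∀ x ∈ I, ∀ y ∈ I, ⁅x, y⁆ = 0 := fun x hx y hy =>
    congrArg Subtype.val (hI.trivial (⟨x, hx⟩ : I) (⟨y, hy⟩ : I))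
  have hof : ∀ (i) (x : ⨁ i, L i) (y : L i), ⁅x, of L i y⁆ = of L i ⁅x i, y⁆ := by
    intro i x y
    ext j
    rw [bracket_apply]
    rcases eq_or_ne j i with rfl | hj
    · simp
    · simp [of_eq_of_ne _ _ _ hj]
  rw [LieSubmodule.eq_bot_iff]
  intro x hx
  ext i
  -- the part of `I` inside the `i`-th summand is an abelian ideal of that summand
  let J : LieIdeal K (L i) :=
    { I.toSubmodule.comap (lof K ι L i) with
      lie_mem := fun {z y} hy => by
        change of L i ⁅z, y⁆ ∈ I
        rw [← lie_of_same]
        exact LieSubmodule.lie_mem _ hy }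
  have hJab : IsLieAbelian J := ⟨fun y z => Subtype.ext <| by
    have h := hIab _ y.2 _ z.2
    change ⁅of L i y, of L i z⁆ = 0 at h
    rw [lie_of_same] at h
    exact of_injective i (h.trans (map_zero _).symm)⟩
  have hJ : J = ⊥ := HasTrivialRadical.eq_bot_of_isSolvable J
  have hxc : x i ∈ LieAlgebra.center K (L i) := by
    rw [LieModule.mem_maxTrivSubmodule]
    intro y
    have : ⁅y, x i⁆ ∈ J := by
      change of L i ⁅y, x i⁆ ∈ I
      rw [← lie_skew, map_neg, neg_mem_iff, ← hof, ← lie_skew, neg_mem_iff]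
      exact LieSubmodule.lie_mem _ hx
    rwa [hJ] at this
  rwa [center_eq_bot] at hxc

end LieAlgebra

namespace LieModule

variable {K L M : Type*} [Field K] [CharZero K] [LieRing L] [LieAlgebra K L]
  [FiniteDimensional K L] [LieAlgebra.IsKilling K L]
  [AddCommGroup M] [Module K M] [FiniteDimensional K M] [LieRingModule L M] [LieModule K L M]

/-- Complete reducibility: every Lie submodule `N` is the image of an equivariant projection. The
decomposition of `lie_top_sup_maxTrivSubmodule` is applied to the Lie module `E` of the linear maps
`M → N` that are scalar on `N`: brackets of elements of `E` vanish on `N`, so the invariant part of a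
linear projection onto `N` is still a projection onto `N`. -/
theorem exists_equivariant_projection (N : LieSubmodule K L M) :
    ∃ p : Module.End K M, (∀ m, p m ∈ N) ∧ (∀ m ∈ N, p m = m) ∧
      ∀ (x : L) (m : M), p ⁅x, m⁆ = ⁅x, p m⁆ := by
  let E : LieSubmodule K L (M →ₗ[K] M) :=
    { carrier := {f | (∀ m, f m ∈ N) ∧ ∃ c : K, ∀ m ∈ N, f m = c • m}
      add_mem' := by
        rintro f f' ⟨hf, c, hc⟩ ⟨hf', c', hc'⟩
        exact ⟨fun m => add_mem (hf m) (hf' m), c + c', fun m hm => by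
          rw [LinearMap.add_apply, hc m hm, hc' m hm, add_smul]⟩
      zero_mem' := ⟨fun m => by simp, 0, fun m _ => by simp⟩
      smul_mem' := by
        rintro a f ⟨hf, c, hc⟩
        exact ⟨fun m => SMulMemClass.smul_mem a (hf m), a * c, fun m hm => by
          rw [LinearMap.smul_apply, hc m hm, mul_smul]⟩
      lie_mem := by
        rintro x f ⟨hf, c, hc⟩
        refine ⟨fun m => ?_, 0, fun m hm => ?_⟩
        · rw [LieHom.lie_apply]
          exact sub_mem (LieSubmodule.lie_mem _ (hf _)) (hf _)
        · rw [LieHom.lie_apply, hc m hm, hc _ (LieSubmodule.lie_mem _ hm)]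
          simp }
  -- brackets of elements of `E` vanish on `N`
  have hV : ∀ f ∈ ⁅(⊤ : LieIdeal K L), (⊤ : LieSubmodule K L E)⁆, ∀ m ∈ N, f.1 m = 0 := by
    intro f hf
    rw [← LieSubmodule.mem_toSubmodule, LieSubmodule.lieIdeal_oper_eq_linear_span'] at hf
    induction hf using Submodule.span_induction with
    | mem f hf =>
      obtain ⟨x, -, f, -, rfl⟩ := hf
      intro m hm
      obtain ⟨-, c, hc⟩ := f.2
      rw [LieSubmodule.coe_bracket, LieHom.lie_apply, hc m hm, hc _ (LieSubmodule.lie_mem _ hm)]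
      simp
    | zero => simp
    | add f f' _ _ h h' =>
      intro m hm
      simp [h m hm, h' m hm]
    | smul a f _ h =>
      intro m hm
      simp [h m hm]
  obtain ⟨π, hπ⟩ := N.toSubmodule.subtype.exists_leftInverse_of_injective
    N.toSubmodule.ker_subtype
  have hπ' : ∀ m (hm : m ∈ N), π m = ⟨m, hm⟩ := fun m hm => LinearMap.congr_fun hπ ⟨m, hm⟩
  let f₀ : E := ⟨N.toSubmodule.subtype ∘ₗ π, fun m => Subtype.property _, 1, fun m hm => by
    simp [hπ' m hm]⟩
  have hf₀ : f₀ ∈ (⊤ : LieSubmodule K L E) := LieSubmodule.mem_top _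
  rw [← lie_top_sup_maxTrivSubmodule] at hf₀
  obtain ⟨q, hq, p, hp, hqp⟩ := (LieSubmodule.mem_sup _ _ _).1 hf₀
  refine ⟨p.1, p.2.1, fun m hm => ?_, fun x m => ?_⟩
  · have h1 : f₀.1 m = m := by simp [f₀, hπ' m hm]
    have h2 : f₀.1 m = q.1 m + p.1 m := by rw [← hqp]; rfl
    rwa [h1, hV q hq m hm, zero_add, eq_comm] at h2
  · rw [mem_maxTrivSubmodule] at hp
    have : ⁅x, p.1⁆ m = 0 := by
      have := congrArg Subtype.val (hp x)
      exact LinearMap.congr_fun this m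
    rw [LieHom.lie_apply, sub_eq_zero] at this
    exact this.symm

end LieModule

/-! ### Generators and semisimplicity of modules over the wreath product algebra -/

section

attribute [local instance 100] LieRing.ofAssociativeRing

/-- The universal enveloping algebra of `g` is generated by the image of `g`. -/
theorem UniversalEnvelopingAlgebra.eq_top_of_forall_ι_mem {k g : Type*} [CommRing k] [LieRing g]
    [LieAlgebra k g] (S : Subalgebra k (UniversalEnvelopingAlgebra k g))
    (hS : ∀ x, UniversalEnvelopingAlgebra.ι k x ∈ S) : S = ⊤ := by
  let j : g →ₗ⁅k⁆ S :=
    { toFun := fun x => ⟨UniversalEnvelopingAlgebra.ι k x, hS x⟩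
      map_add' := fun x y => Subtype.ext (map_add _ x y)
      map_smul' := fun c x => Subtype.ext (map_smul _ c x)
      map_lie' := fun {x y} => Subtype.ext (LieHom.map_lie _ x y) }
  have h : S.val.comp (UniversalEnvelopingAlgebra.lift k j) = AlgHom.id k _ := by
    ext x
    simp [j]
  rw [eq_top_iff]
  intro a _
  rw [← AlgHom.id_apply (R := k) a, ← h]
  exact Subtype.property _

/-- A finite tensor product of algebras is generated by the images of its factors. -/
theorem PiTensorProduct.eq_top_of_forall_singleAlgHom_mem {k ι : Type*} [CommRing k] [Fintype ι]
    [DecidableEq ι] {A : ι → Type*} [∀ i, Ring (A i)] [∀ i, Algebra k (A i)]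
    (S : Subalgebra k (⨂[k] i, A i)) (hS : ∀ i a, PiTensorProduct.singleAlgHom i a ∈ S) :
    S = ⊤ := by
  rw [eq_top_iff]
  intro x _
  induction x using PiTensorProduct.induction_on with
  | add x y hx hy => exact add_mem (hx trivial) (hy trivial)
  | smul_tprod r a =>
    refine S.smul_mem ?_ r
    have h := PiTensorProduct.tprod_noncommProd (R := k) Finset.univ
      (fun i => Pi.mulSingle i (a i)) fun i _ j _ _ => Pi.mulSingle_apply_commute a i j
    rw [Finset.noncommProd_mulSingle a] at h
    rw [h]
    exact S.toSubmonoid.noncommProd_mem _ _ _ fun i _ => hS i (a i)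

namespace WreathAlgebra

variable {k : Type u} [CommRing k] {A : Type v} [Ring A] [Algebra k A] {n : ℕ}

variable (k A n) in
/-- The inclusion of `A^{⊗ n}` in the wreath product algebra. -/
noncomputable def base : (⨂[k] _ : Fin n, A) →ₐ[k] WreathAlgebra k A n where
  __ := SkewMonoidAlgebra.singleOneRingHom
  commutes' _ := rfl

theorem base_apply (a : ⨂[k] _ : Fin n, A) : base k A n a = SkewMonoidAlgebra.single 1 a := rfl

variable (k A) in
/-- The inclusion of the symmetric group in the wreath product algebra. -/
noncomputable def perm (σ : Equiv.Perm (Fin n)) : WreathAlgebra k A n := SkewMonoidAlgebra.single σ 1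

theorem perm_mul (σ τ : Equiv.Perm (Fin n)) : perm k A (σ * τ) = perm k A σ * perm k A τ := by
  simp [perm]

theorem perm_one : perm k A (1 : Equiv.Perm (Fin n)) = 1 := rfl

theorem single_eq (σ : Equiv.Perm (Fin n)) (a : ⨂[k] _ : Fin n, A) :
    SkewMonoidAlgebra.single σ a = base k A n a * perm k A σ := by
  simp [perm, base_apply]

theorem perm_mul_base (σ : Equiv.Perm (Fin n)) (a : ⨂[k] _ : Fin n, A) :
    perm k A σ * base k A n a = base k A n (σ • a) * perm k A σ := by
  simp [perm, base_apply]

/-- The inclusion of `A` in the wreath product algebra through the `i`-th tensor factor. -/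
noncomputable def factor (k : Type u) [CommRing k] (A : Type v) [Ring A] [Algebra k A] {n : ℕ}
    (i : Fin n) : A →ₐ[k] WreathAlgebra k A n :=
  (base k A n).comp (PiTensorProduct.singleAlgHom (A := fun _ : Fin n => A) i)

theorem commute_factor {i j : Fin n} (h : i ≠ j) (a b : A) :
    Commute (factor k A i a) (factor k A j b) := by
  have : Commute (PiTensorProduct.singleAlgHom (R := k) (A := fun _ : Fin n => A) i a)
      (PiTensorProduct.singleAlgHom (R := k) (A := fun _ : Fin n => A) j b) :=
    Commute.tprod (Pi.mulSingle_commute (f := fun _ : Fin n => A) h a b)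
  exact this.map (base k A n)

/-- The wreath product algebra is generated by the `n` copies of `A` and the permutations. -/
theorem eq_top_of_forall_mem (S : Subalgebra k (WreathAlgebra k A n))
    (hfactor : ∀ i a, factor k A i a ∈ S) (hperm : ∀ σ, perm k A σ ∈ S) : S = ⊤ := by
  have hbase : S.comap (base k A n) = ⊤ :=
    PiTensorProduct.eq_top_of_forall_singleAlgHom_mem _ hfactor
  rw [eq_top_iff]
  intro x _
  induction x using SkewMonoidAlgebra.induction_on with
  | zero => exact zero_mem S
  | single σ a =>
    rw [single_eq]
    exact mul_mem (hbase ▸ trivial : a ∈ S.comap (base k A n)) (hperm σ)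
  | add x y hx hy => exact add_mem (hx trivial) (hy trivial)

/-- Every finite-dimensional module over `S_n ≀ U(g)` is semisimple. A submodule is the image of a
projection that is equivariant for the semisimple Lie algebra `g^n`, hence linear over
`U(g)^{⊗ n}`; its average over the conjugates by `S_n` is a projection that is linear over the whole
wreath product algebra. -/
theorem isSemisimpleModule {k : Type u} [Field k] [CharZero k] {g : Type v} [LieRing g]
    [LieAlgebra k g] [FiniteDimensional k g] [LieAlgebra.IsKilling k g] {n : ℕ} (M : Type*)
    [AddCommGroup M] [Module k M] [Module (WreathAlgebra k (UniversalEnvelopingAlgebra k g) n) M]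
    [IsScalarTower k (WreathAlgebra k (UniversalEnvelopingAlgebra k g) n) M]
    [FiniteDimensional k M] :
    IsSemisimpleModule (WreathAlgebra k (UniversalEnvelopingAlgebra k g) n) M := by
  classical
  let U := UniversalEnvelopingAlgebra k g
  let R := WreathAlgebra k U n
  let ρ : R →ₐ[k] Module.End k M := Algebra.lsmul k k M
  -- the Lie algebra `g^n` acts on `M`
  let F : (DirectSum (Fin n) fun _ => g) →ₗ⁅k⁆ Module.End k M :=
    DirectSum.toLieAlgebra (Module.End k M)
      (fun i => ((ρ.comp (factor k U i) : U →ₐ[k] Module.End k M) :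
        U →ₗ⁅k⁆ Module.End k M).comp (UniversalEnvelopingAlgebra.ι k))
      fun i j hij x y => ((commute_factor hij _ _).map ρ).lie_eq
  have hF : ∀ i x, F (DirectSum.of _ i x) =
      ρ (factor k U i (UniversalEnvelopingAlgebra.ι k x)) := by
    intro i x
    exact DirectSum.toModule_lof (M := fun _ : Fin n => g) k i x
  let : LieRingModule (DirectSum (Fin n) fun _ => g) M := LieRingModule.compLieHom M F
  have : LieModule k (DirectSum (Fin n) fun _ => g) M := LieModule.compLieHom M F
  have hlie : ∀ i x (m : M), ⁅DirectSum.of (fun _ : Fin n => g) i x, m⁆ =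
      factor k U i (UniversalEnvelopingAlgebra.ι k x) • m := by
    intro i x m
    rw [LieRingModule.compLieHom_apply, hF]
    rfl
  rw [isSemisimpleModule_iff]
  refine ⟨fun N => ?_⟩
  let N' : LieSubmodule k (DirectSum (Fin n) fun _ => g) M :=
    { N.restrictScalars k with
      lie_mem := by
        intro x m hm
        induction x using DirectSum.induction_on with
        | zero => simp
        | of i x => rw [hlie]; exact N.smul_mem _ hm
        | add x y hx hy => rw [add_lie]; exact add_mem hx hy }
  obtain ⟨p, hpN, hp, hpcomm⟩ := LieModule.exists_equivariant_projection N'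
  -- a linear map is linear over the subalgebra of elements with which it commutes
  have hfactor : ∀ i a, Commute (ρ (factor k U i a)) p := by
    intro i
    let S : Subalgebra k U := (Subalgebra.centralizer k {p}).comap (ρ.comp (factor k U i))
    have hS : S = ⊤ := UniversalEnvelopingAlgebra.eq_top_of_forall_ι_mem S fun x => by
      rw [Subalgebra.mem_comap, Subalgebra.mem_centralizer_iff]
      rintro _ rfl
      ext m
      have := hpcomm (DirectSum.of _ i x) m
      rwa [hlie, hlie] at this
    intro a
    have ha : a ∈ S := hS ▸ trivial
    rw [Subalgebra.mem_comap, Subalgebra.mem_centralizer_iff] at ha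
    exact (ha p rfl).symm
  have hbase : ∀ a, Commute (ρ (base k U n a)) p := by
    let S := (Subalgebra.centralizer k {p}).comap (ρ.comp (base k U n))
    have hS : S = ⊤ := PiTensorProduct.eq_top_of_forall_singleAlgHom_mem S fun i a => by
      rw [Subalgebra.mem_comap, Subalgebra.mem_centralizer_iff]
      rintro _ rfl
      exact (hfactor i a).symm
    intro a
    have ha : a ∈ S := hS ▸ trivial
    rw [Subalgebra.mem_comap, Subalgebra.mem_centralizer_iff] at ha
    exact (ha p rfl).symm
  -- average `p` over the symmetric group
  let q : Module.End k M := ((Fintype.card (Equiv.Perm (Fin n)) : k)⁻¹) •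
    ∑ σ : Equiv.Perm (Fin n), ρ (perm k U σ) * p * ρ (perm k U σ⁻¹)
  have hqN : ∀ m, q m ∈ N := fun m => by
    refine (N.restrictScalars k).smul_mem _ ?_
    rw [LinearMap.sum_apply]
    exact sum_mem fun σ _ => N.smul_mem _ (hpN _)
  have hq : ∀ m ∈ N, q m = m := fun m hm => by
    have h : ∀ σ : Equiv.Perm (Fin n), (ρ (perm k U σ) * p * ρ (perm k U σ⁻¹)) m = m := by
      intro σ
      change perm k U σ • p (perm k U σ⁻¹ • m) = m
      rw [hp _ (N.smul_mem _ hm), ← mul_smul, ← perm_mul, mul_inv_cancel, perm_one, one_smul]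
    simp only [q, LinearMap.smul_apply, LinearMap.sum_apply, h, Finset.sum_const,
      Finset.card_univ]
    rw [← Nat.cast_smul_eq_nsmul k, smul_smul, inv_mul_cancel₀ (by simp), one_smul]
  have hqR : ∀ (r : R) m, q (r • m) = r • q m := by
    let S : Subalgebra k R := (Subalgebra.centralizer k {q}).comap ρ
    have hS : S = ⊤ := by
      refine eq_top_of_forall_mem S (fun i a => ?_) (fun τ => ?_)
      · rw [Subalgebra.mem_comap, Subalgebra.mem_centralizer_iff]
        rintro _ rfl
        refine (Commute.smul_right (Commute.sum_right _ _ _ fun σ _ => ?_) _).symm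
        set t := PiTensorProduct.singleAlgHom (R := k) (A := fun _ : Fin n => U) i a
        have h1 : ρ (base k U n t) * ρ (perm k U σ) =
            ρ (perm k U σ) * ρ (base k U n (σ⁻¹ • t)) := by
          rw [← map_mul, ← map_mul, perm_mul_base, smul_inv_smul]
        have h2 : ρ (perm k U σ⁻¹) * ρ (base k U n t) =
            ρ (base k U n (σ⁻¹ • t)) * ρ (perm k U σ⁻¹) := by
          rw [← map_mul, ← map_mul, perm_mul_base]
        change ρ (base k U n t) * (ρ (perm k U σ) * p * ρ (perm k U σ⁻¹)) =
          ρ (perm k U σ) * p * ρ (perm k U σ⁻¹) * ρ (base k U n t)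
        rw [mul_assoc _ _ (ρ (base k U n t)), h2, ← mul_assoc, ← mul_assoc, h1,
          mul_assoc (ρ (perm k U σ)), (hbase _).eq, ← mul_assoc, ← mul_assoc]
      · rw [Subalgebra.mem_comap, Subalgebra.mem_centralizer_iff]
        rintro _ rfl
        simp only [q, smul_mul_assoc, mul_smul_comm, Finset.sum_mul, Finset.mul_sum]
        congr 1
        refine (Fintype.sum_equiv (Equiv.mulLeft τ) _ _ fun σ => ?_).symm
        simp only [Equiv.coe_mulLeft, mul_inv_rev, perm_mul, map_mul, mul_assoc]
        rw [← map_mul ρ (perm k U τ⁻¹), ← perm_mul, inv_mul_cancel, perm_one, map_one, mul_one]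
    intro r m
    have hr : r ∈ S := hS ▸ trivial
    rw [Subalgebra.mem_comap, Subalgebra.mem_centralizer_iff] at hr
    exact LinearMap.congr_fun (hr q rfl) m
  let Q : M →ₗ[R] N :=
    { toFun := fun m => ⟨q m, hqN m⟩
      map_add' := fun a b => Subtype.ext (map_add q a b)
      map_smul' := fun r m => Subtype.ext (hqR r m) }
  exact ⟨_, LinearMap.isCompl_of_proj (f := Q) fun m => Subtype.ext (hq m m.2)⟩

end WreathAlgebra

end

/-! ### Semisimple objects of the category of finite-dimensional modules -/

namespace FinDimModuleCat

variable {k : Type u} [Field k] {R : Type v} [Ring R] [Algebra k R]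

/-- The object of `FinDimModuleCat k R` given by a finite-dimensional module. -/
noncomputable def of (k : Type u) [Field k] (R : Type v) [Ring R] [Algebra k R] (M : Type w)
    [AddCommGroup M] [Module k M] [Module R M] [IsScalarTower k R M] [FiniteDimensional k M] :
    FinDimModuleCat.{u, v, w} k R :=
  ⟨ModuleCat.of R M, by
    have h : (Module.compHom M (algebraMap k R) : Module k M) = ‹Module k M› :=
      Module.ext' _ _ fun r m => algebraMap_smul R r m
    change @FiniteDimensional k M _ _ (Module.compHom M (algebraMap k R))
    rw [h]
    infer_instance⟩

/-- The morphism of `FinDimModuleCat k R` given by a linear map. -/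
abbrev ofHom {X Y : FinDimModuleCat.{u, v, w} k R} (f : X.obj →ₗ[R] Y.obj) : X ⟶ Y :=
  ObjectProperty.homMk (ModuleCat.ofHom f)

theorem simple_of_isSimpleModule_obj (X : FinDimModuleCat.{u, v, w} k R)
    [IsSimpleModule R X.obj] : Simple X := by
  have := (isFinDim.{u, v, w} k R).preservesMonomorphisms_ι_of_isNormalEpiCategory
  have : Simple ((isFinDim.{u, v, w} k R).ι.obj X) := (simple_iff_isSimpleModule' _).2 ‹_›
  exact (isFinDim.{u, v, w} k R).ι.simple_of_simple_obj X

theorem finite_obj (X : FinDimModuleCat.{u, v, w} k R) : Module.Finite R X.obj := by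
  let : Module k X.obj := Module.compHom X.obj (algebraMap k R)
  have : IsScalarTower k R X.obj := IsScalarTower.of_algebraMap_smul fun _ _ => rfl
  have : FiniteDimensional k X.obj := X.property
  exact Module.Finite.of_restrictScalars_finite k R X.obj

/-- The object of `FinDimModuleCat k R` given by a submodule of an object. -/
abbrev ofSubmodule (X : FinDimModuleCat.{u, v, w} k R) (N : Submodule R X.obj) :
    FinDimModuleCat.{u, v, w} k R :=
  ⟨ModuleCat.of R N,
    have : Mono (ModuleCat.ofHom N.subtype) :=
      (ModuleCat.mono_iff_injective (ModuleCat.ofHom N.subtype)).2 N.subtype_injective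
    (isFinDim k R).prop_of_mono (ModuleCat.ofHom N.subtype) X.property⟩

/-- The decomposition of a semisimple module into simple submodules, in `FinDimModuleCat k R`. -/
theorem exists_iso_biproduct (X : FinDimModuleCat.{u, v, w} k R) [IsSemisimpleModule R X.obj] :
    haveI : HasFiniteBiproducts (FinDimModuleCat.{u, v, w} k R) := Abelian.hasFiniteBiproducts
    ∃ (m : ℕ) (S : Fin m → FinDimModuleCat.{u, v, w} k R), (∀ i, IsSimpleModule R (S i).obj) ∧
      Nonempty (X ≅ ⨁ S) := by
  classical
  have : HasFiniteBiproducts (FinDimModuleCat.{u, v, w} k R) := Abelian.hasFiniteBiproducts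
  have := finite_obj X
  obtain ⟨m, S, e₀, hS⟩ := IsSemisimpleModule.exists_linearEquiv_fin_dfinsupp R X.obj
  let e : X.obj ≃ₗ[R] ∀ i, S i := e₀.trans DFinsupp.linearEquivFunOnFintype
  let p (i : Fin m) : X.obj →ₗ[R] S i := LinearMap.proj i ∘ₗ e.toLinearMap
  let s (i : Fin m) : S i →ₗ[R] X.obj :=
    e.symm.toLinearMap ∘ₗ LinearMap.single R (fun i => S i) i
  have hps : ∀ i x, p i (s i x) = x := fun i x => by simp [p, s]
  have hps' : ∀ i j, i ≠ j → ∀ x, p j (s i x) = 0 := fun i j h x => by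
    simp [p, s, Pi.single_eq_of_ne h.symm]
  have hsp : ∀ x, ∑ i, s i (p i x) = x := fun x => by
    apply e.injective
    simp [p, s, map_sum, Finset.univ_sum_single]
  let c : Bicone fun i => ofSubmodule X (S i) :=
    { pt := X
      π := fun i => ofHom (X := X) (Y := ofSubmodule X (S i)) (p i)
      ι := fun i => ofHom (X := ofSubmodule X (S i)) (Y := X) (s i)
      ι_π := by
        intro i j
        split_ifs with h
        · subst h
          ext x
          exact congrArg Subtype.val (hps i x)
        · ext x
          exact congrArg Subtype.val (hps' i j h x) }
  refine ⟨m, fun i => ofSubmodule X (S i), hS, ⟨biproduct.uniqueUpToIso _ (b := c) ?_⟩⟩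
  refine isBilimitOfTotal c ?_
  apply ObjectProperty.hom_ext
  have h : (∑ j, c.π j ≫ c.ι j).hom = ∑ j, ModuleCat.ofHom (s j ∘ₗ p j) :=
    map_sum (isFinDim.{u, v, w} k R).ι.mapAddHom _ _
  rw [h]
  ext x
  rw [ModuleCat.hom_sum, LinearMap.sum_apply]
  exact hsp x

end FinDimModuleCat

/-! ### Tensor powers of representations -/

section

attribute [local instance 100] LieRing.ofAssociativeRing

/-- If `h` has an eigenvector `e` of eigenvalue `c` in the adjoint representation of `g`, then it has
the eigenvector `e ⊗ ⋯ ⊗ e` of eigenvalue `d * c` in the `d`-th tensor power of that representation.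
The representation space is identified with some `k ^ N`, which frees its universe from that of
`g`. -/
theorem exists_representation_eigenvector {k g : Type*} [Field k] [LieRing g] [LieAlgebra k g]
    [FiniteDimensional k g] {h e : g} {c : k} (he : e ≠ 0) (hhe : ⁅h, e⁆ = c • e) (d : ℕ) :
    ∃ (N : ℕ) (ρ : g →ₗ⁅k⁆ Module.End k (Fin N → k)) (w : Fin N → k),
      w ≠ 0 ∧ ρ h w = (d * c) • w := by
  induction d with
  | zero => exact ⟨1, 0, 1, one_ne_zero, by simp⟩
  | succ d ih =>
    obtain ⟨N, ρ, w, hw, hρ⟩ := ih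
    let : LieRingModule g (Fin N → k) := LieRingModule.compLieHom (Fin N → k) ρ
    have : LieModule k g (Fin N → k) := LieModule.compLieHom (Fin N → k) ρ
    let E := (Module.finBasis k (g ⊗[k] (Fin N → k))).equivFun
    refine ⟨_, (E.lieConj : _ →ₗ⁅k⁆ _).comp (LieModule.toEnd k g (g ⊗[k] (Fin N → k))),
      E (e ⊗ₜ w), ?_, ?_⟩
    · rw [E.map_ne_zero_iff]
      intro h0
      obtain ⟨f, hf⟩ : ∃ f : Module.Dual k g, f e ≠ 0 := by
        by_contra! hf
        exact he ((Module.forall_dual_apply_eq_zero_iff k e).1 hf)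
      have := congrArg ((TensorProduct.lid k (Fin N → k)).toLinearMap ∘ₗ f.rTensor (Fin N → k)) h0
      simp [hf, hw] at this
    · have h1 : ⁅h, w⁆ = (d * c) • w := hρ
      have h2 : ⁅h, e ⊗ₜ[k] w⁆ = ((d + 1 : ℕ) * c) • e ⊗ₜ[k] w := by
        rw [TensorProduct.LieModule.lie_tmul_right, hhe, h1, TensorProduct.tmul_smul,
          ← TensorProduct.smul_tmul', ← add_smul]
        congr 1
        push_cast
        ring
      change E.conj (LieModule.toEnd k g _ h) (E (e ⊗ₜ w)) = _
      simp [LinearEquiv.conj_apply, h2]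

namespace WreathAlgebra

variable {k : Type u} [Field k] {A : Type v} [Ring A] [Algebra k A] {n : ℕ}
  {W : Type w} [AddCommGroup W] [Module k W]

/-- The tensor power `W^{⊗ n}` of a representation `W` of `A`, as a representation of `S_n ≀ A`:
`A^{⊗ n}` acts factor by factor and `S_n` permutes the tensor factors. -/
noncomputable def tensorPowerRep (ρ : A →ₐ[k] Module.End k W) :
    WreathAlgebra k A n →ₐ[k] Module.End k (⨂[k] _ : Fin n, W) :=
  SkewMonoidAlgebra.liftNCAlgHom
    (PiTensorProduct.liftAlgHom
      ((PiTensorProduct.mapMultilinear k (fun _ : Fin n => W) (fun _ => W)).compLinearMap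
        fun _ => ρ.toLinearMap)
      (by
        ext w
        simp)
      (fun a b => by
        ext w
        simp))
    { toFun := fun σ => (PiTensorProduct.reindex k (fun _ : Fin n => W) σ).toLinearMap
      map_one' := by
        ext w
        simp
        rfl
      map_mul' := fun σ τ => by
        ext w
        simp
        rfl }
    (fun {a σ} => by
      induction a using PiTensorProduct.induction_on with
      | add a b ha hb => simp only [smul_add, map_add, add_mul, mul_add, ha, hb]
      | smul_tprod r a =>
        ext w
        rw [smul_comm, perm_smul_tprod]
        simp)

theorem tensorPowerRep_factor_tprod (ρ : A →ₐ[k] Module.End k W) (i : Fin n) (a : A) {w : W}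
    {c : k} (h : ρ a w = c • w) :
    tensorPowerRep ρ (factor k A i a) (PiTensorProduct.tprod k fun _ => w) =
      c • PiTensorProduct.tprod k fun _ => w := by
  have h1 : tensorPowerRep ρ (factor k A i a) (PiTensorProduct.tprod k fun _ => w) =
      PiTensorProduct.tprod k fun j => ρ (Pi.mulSingle (M := fun _ : Fin n => A) i a j) w := by
    have h2 : tensorPowerRep (n := n) ρ (factor k A i a) = _ :=
      SkewMonoidAlgebra.liftNC_single _ _ _ _
    rw [h2]
    simp
  have h2 : (fun j => ρ (Pi.mulSingle (M := fun _ : Fin n => A) i a j) w) =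
      Function.update (fun _ => w) i (c • w) := by
    ext j
    rcases eq_or_ne j i with rfl | hj
    · simp [h]
    · simp [hj]
  rw [h1, h2, MultilinearMap.map_update_smul, Function.update_eq_self]

end WreathAlgebra

theorem PiTensorProduct.tprod_const_ne_zero {k ι W : Type*} [Field k] [Fintype ι]
    [AddCommGroup W] [Module k W] {w : W} (h : w ≠ 0) :
    (PiTensorProduct.tprod k fun _ : ι => w) ≠ 0 := by
  intro h0
  obtain ⟨f, hf⟩ : ∃ f : Module.Dual k W, f w ≠ 0 := by
    by_contra! hf
    exact h ((Module.forall_dual_apply_eq_zero_iff k w).1 hf)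
  have := congrArg (PiTensorProduct.lift
    ((MultilinearMap.mkPiAlgebra k ι k).compLinearMap fun _ => f)) h0
  simp [hf] at this

end

/-! ### Infinitely many simple objects -/

namespace FinDimModuleCat

variable {k : Type u} [Field k] {R : Type v} [Ring R] [Algebra k R]

/-- The eigenvalues in `k` of the action of `r : R` on an object of `FinDimModuleCat k R`. -/
def eigenvalues (r : R) (X : FinDimModuleCat.{u, v, w} k R) : Set k :=
  {c | ∃ m : X.obj, m ≠ 0 ∧ r • m = algebraMap k R c • m}

theorem finite_eigenvalues (r : R) (X : FinDimModuleCat.{u, v, w} k R) :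
    (eigenvalues r X).Finite := by
  let : Module k X.obj := Module.compHom X.obj (algebraMap k R)
  have : IsScalarTower k R X.obj := IsScalarTower.of_algebraMap_smul fun _ _ => rfl
  have : FiniteDimensional k X.obj := X.property
  refine (Module.End.finite_hasEigenvalue (Algebra.lsmul k k X.obj r)).subset ?_
  rintro c ⟨m, hm, h⟩
  exact Module.End.hasEigenvalue_of_hasEigenvector
    (Module.End.hasEigenvector_iff.2 ⟨Module.End.mem_eigenspace_iff.2 h, hm⟩)

theorem eigenvalues_subset_of_iso (r : R) {X Y : FinDimModuleCat.{u, v, w} k R} (e : X ≅ Y) :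
    eigenvalues r X ⊆ eigenvalues r Y := by
  rintro c ⟨m, hm, h⟩
  let f : X.obj →ₗ[R] Y.obj := e.hom.hom.hom
  let f' : Y.obj →ₗ[R] X.obj := e.inv.hom.hom
  have hf : ∀ x, f' (f x) = x := fun x =>
    congrArg (fun φ : X ⟶ X => (φ.hom.hom : X.obj →ₗ[R] X.obj) x) e.hom_inv_id
  refine ⟨f m, fun h0 => hm ?_, ?_⟩
  · rw [← hf m, h0, map_zero]
  · rw [← map_smul, h, map_smul]

/-- A sequence of objects on which `r` has the pairwise distinct eigenvalues `c d` meets infinitely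
many isomorphism classes, as `r` has only finitely many eigenvalues on each object. -/
theorem exists_pairwise_not_iso (r : R) (S : ℕ → FinDimModuleCat.{u, v, w} k R) {c : ℕ → k}
    (hc : Function.Injective c) (hS : ∀ d, c d ∈ eigenvalues r (S d)) :
    ∃ t : ℕ → ℕ, ∀ i j, Nonempty (S (t i) ≅ S (t j)) → i = j := by
  let q : ℕ → Quotient (isIsomorphicSetoid (FinDimModuleCat.{u, v, w} k R)) := fun d => ⟦S d⟧
  have hq : (Set.range q).Infinite := by
    intro hfin
    choose! s hs using fun y (hy : y ∈ Set.range q) => hy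
    refine Set.infinite_range_of_injective hc
      ((hfin.biUnion fun y _ => finite_eigenvalues r (S (s y))).subset ?_)
    rintro _ ⟨d, rfl⟩
    obtain ⟨e⟩ : IsIsomorphic (S (s (q d))) (S d) := Quotient.exact (hs (q d) ⟨d, rfl⟩)
    exact Set.mem_biUnion ⟨d, rfl⟩ (eigenvalues_subset_of_iso r e.symm (hS d))
  let f := hq.natEmbedding
  choose t ht using fun j => (f j).2
  refine ⟨t, fun i j h => f.injective (Subtype.ext ?_)⟩
  rw [← ht i, ← ht j]
  exact Quotient.sound h

end FinDimModuleCat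

section

attribute [local instance 100] LieRing.ofAssociativeRing

open FinDimModuleCat in
/-- An eigenvalue `c` of `h : g` on a representation `k ^ N` is an eigenvalue of `h ⊗ 1 ⊗ ⋯ ⊗ 1`, or
of any other copy of `h` in `U(g)^{⊗ n}`, on some simple object: on a simple summand of the `n`-th
tensor power of `k ^ N` on which the component of `x ⊗ ⋯ ⊗ x` is not zero. -/
theorem WreathAlgebra.exists_simple_mem_eigenvalues {k : Type} [Field k] [CharZero k]
    {g : Type v} [LieRing g] [LieAlgebra k g] [FiniteDimensional k g] [LieAlgebra.IsKilling k g]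
    {n N : ℕ} (i : Fin n) (ρ : g →ₗ⁅k⁆ Module.End k (Fin N → k)) {h : g} {x : Fin N → k}
    (hx : x ≠ 0) {c : k} (hc : ρ h x = c • x) :
    ∃ S : FinDimModuleCat.{0, v, w} k (WreathAlgebra k (UniversalEnvelopingAlgebra k g) n),
      Simple S ∧ c ∈ eigenvalues
        (factor k (UniversalEnvelopingAlgebra k g) i (UniversalEnvelopingAlgebra.ι k h)) S := by
  let U := UniversalEnvelopingAlgebra k g
  let R := WreathAlgebra k U n
  let P : R →ₐ[k] Module.End k (⨂[k] _ : Fin n, (Fin N → k)) :=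
    tensorPowerRep (UniversalEnvelopingAlgebra.lift k ρ)
  let : Module R (⨂[k] _ : Fin n, (Fin N → k)) := Module.compHom _ P.toRingHom
  have : IsScalarTower k R (⨂[k] _ : Fin n, (Fin N → k)) :=
    IsScalarTower.of_algebraMap_smul fun a m => by
      change P (algebraMap k R a) m = a • m
      rw [P.commutes]; rfl
  let M := ULift.{w} (⨂[k] _ : Fin n, (Fin N → k))
  have : IsSemisimpleModule R M := WreathAlgebra.isSemisimpleModule M
  let X := FinDimModuleCat.of k R M
  have : IsSemisimpleModule R X.obj := ‹IsSemisimpleModule R M›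
  have := finite_obj X
  obtain ⟨m, S, e, hS⟩ := IsSemisimpleModule.exists_linearEquiv_fin_dfinsupp R X.obj
  let y : X.obj := ULift.up (PiTensorProduct.tprod k fun _ : Fin n => x)
  have hy0 : y ≠ 0 := fun h0 => PiTensorProduct.tprod_const_ne_zero hx (congrArg ULift.down h0)
  have hy : factor k U i (UniversalEnvelopingAlgebra.ι k h) • y = algebraMap k R c • y := by
    refine congrArg ULift.up
      ((tensorPowerRep_factor_tprod _ i _ ?_).trans (algebraMap_smul R c _).symm)
    rw [UniversalEnvelopingAlgebra.lift_ι_apply, hc]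
  obtain ⟨j, hj⟩ : ∃ j, e y j ≠ 0 := by
    by_contra! hj
    exact hy0 (e.map_eq_zero_iff.1 (DFinsupp.ext hj))
  refine ⟨ofSubmodule X (S j), ?_, e y j, hj, ?_⟩
  · have := hS j
    exact simple_of_isSimpleModule_obj (ofSubmodule X (S j))
  · have := congrArg (fun z => e z j) hy
    simp only [map_smul] at this
    exact this

end

/-! ### Dominant integral weights -/

/-- A linear form on `H` is determined by its values on the simple coroots, which span `H`. -/
theorem dual_ext_of_simple_coroots {g : Type u} [LieRing g] [LieAlgebra ℂ g]
    [FiniteDimensional ℂ g] [LieAlgebra.IsSemisimple ℂ g] {H : LieSubalgebra ℂ g}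
    [H.IsCartanSubalgebra] {b : (LieAlgebra.IsKilling.rootSystem H).Base}
    {μ ν : Module.Dual ℂ H}
    (h : ∀ i ∈ b.support, μ ((LieAlgebra.IsKilling.rootSystem H).coroot i) =
      ν ((LieAlgebra.IsKilling.rootSystem H).coroot i)) : μ = ν := by
  have hspan : Submodule.span ℂ ((LieAlgebra.IsKilling.rootSystem H).coroot '' b.support) = ⊤ := by
    rw [b.span_coroot_support]
    exact RootPairing.IsRootSystem.span_coroot_eq_top
  refine LinearMap.ext_on hspan ?_
  rintro _ ⟨i, hi, rfl⟩
  exact h i hi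

theorem countable_dominantIntegralWeights {g : Type u} [LieRing g] [LieAlgebra ℂ g]
    [FiniteDimensional ℂ g] [LieAlgebra.IsSemisimple ℂ g] {H : LieSubalgebra ℂ g}
    [H.IsCartanSubalgebra] (b : (LieAlgebra.IsKilling.rootSystem H).Base) :
    Countable (dominantIntegralWeights b) := by
  choose c hc using fun μ : dominantIntegralWeights b => μ.2
  refine Function.Injective.countable (f := fun μ (i : b.support) => c μ i i.2) fun μ ν h => ?_
  refine Subtype.ext (dual_ext_of_simple_coroots (b := b) fun i hi => ?_)
  have : c μ i hi = c ν i hi := congrFun h ⟨i, hi⟩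
  rw [hc μ i hi, hc ν i hi, this]

/-! ### Semisimplicity and the number of simple objects -/

theorem proposition1p1 {g : Type u} [LieRing g] [LieAlgebra ℂ g] [FiniteDimensional ℂ g]
    [LieAlgebra.IsSemisimple ℂ g] (H : LieSubalgebra ℂ g) [H.IsCartanSubalgebra]
    (b : (LieAlgebra.IsKilling.rootSystem H).Base) (n : ℕ) (hn : 1 ≤ n) :
    -- finite-dimensional modules over the wreath product form a semisimple category
    IsSemisimpleCategory
      (FinDimModuleCat.{0, u, w} ℂ (WreathAlgebra ℂ (UniversalEnvelopingAlgebra ℂ g) n)) ∧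
    -- it has pairwise non-isomorphic simple objects indexed by the dominant integral weights
    ∃ V : dominantIntegralWeights b →
        FinDimModuleCat.{0, u, w} ℂ (WreathAlgebra ℂ (UniversalEnvelopingAlgebra ℂ g) n),
      (∀ μ, Simple (V μ)) ∧ ∀ μ ν, Nonempty (V μ ≅ V ν) → μ = ν := by
  constructor
  · intro X
    let R := WreathAlgebra ℂ (UniversalEnvelopingAlgebra ℂ g) n
    let : Module ℂ X.obj := Module.compHom X.obj (algebraMap ℂ R)
    have : IsScalarTower ℂ R X.obj := IsScalarTower.of_algebraMap_smul fun _ _ => rfl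
    have : FiniteDimensional ℂ X.obj := X.property
    have : IsSemisimpleModule R X.obj := WreathAlgebra.isSemisimpleModule X.obj
    obtain ⟨m, S, hS, h⟩ := FinDimModuleCat.exists_iso_biproduct X
    exact ⟨m, S, fun i => have := hS i; FinDimModuleCat.simple_of_isSimpleModule_obj _, h⟩
  · let i₀ : Fin n := ⟨0, hn⟩
    -- without simple roots there is at most one weight, so that one simple object is enough
    rcases b.support.eq_empty_or_nonempty with hb | ⟨i, -⟩
    · obtain ⟨S, hS, -⟩ := WreathAlgebra.exists_simple_mem_eigenvalues.{u, w} (k := ℂ) (g := g)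
        (N := 1) i₀ 0 (h := 0) (x := 1) one_ne_zero (c := 0) (by simp)
      exact ⟨fun _ => S, fun _ => hS, fun μ ν _ =>
        Subtype.ext (dual_ext_of_simple_coroots (b := b) fun i hi => by simp [hb] at hi)⟩
    · obtain ⟨h, e, f, ht, -, -⟩ :=
        LieAlgebra.IsKilling.exists_isSl2Triple_of_weight_isNonZero
          (LieSubalgebra.isNonZero_coe_root i)
      -- `h` has eigenvalue `2` on the root vector `e`, so every `2 * d` is an eigenvalue of the
      -- first copy of `h` on some simple object
      have hS : ∀ d : ℕ, _ := fun d =>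
        let ⟨_, ρ, _, hx, hρ⟩ := exists_representation_eigenvector ht.e_ne_zero
          (ht.lie_h_e_smul ℂ) d
        WreathAlgebra.exists_simple_mem_eigenvalues.{u, w} i₀ ρ hx hρ
      choose S hsimple hmem using hS
      obtain ⟨t, ht⟩ := FinDimModuleCat.exists_pairwise_not_iso _ S
        (fun a b hab => Nat.cast_injective (mul_right_cancel₀ two_ne_zero hab)) hmem
      have := countable_dominantIntegralWeights b
      obtain ⟨φ, hφ⟩ := Countable.exists_injective_nat (dominantIntegralWeights b)
      exact ⟨fun μ => S (t (φ μ)), fun μ => hsimple _, fun μ ν hμν => hφ (ht _ _ hμν)⟩
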